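/- Let $\mathrm{eCFC}_{\mathbb N}$ be the problem whose inputs are the pairs $(k,A)$ with $k\in\mathbb N$, $A\subseteq\mathbb N$ and $|\mathbb N\setminus A|\le k$, where $k$ is given explicitly and $A$ is given by an enumeration of its complement, and whose solutions on $(k,A)$ are the elements $n\in A$. Let $\mathrm{TT}^1_2$ be the problem whose inputs are the colourings $c:2^{<\omega}\to\{0,1\}$ of the full binary tree, and whose solutions on $c$ are (the characteristic functions of) the sets $S\subseteq 2^{<\omega}$ on which $c$ is constant and which are copies of $2^{<\omega}$. Then $$\mathrm{eCFC}_{\mathbb N}\le_{\mathrm W}\mathrm{TT}^1_2 ,$$ that is, there are computable partial functions $H,K:\subseteq\mathbb N^{\mathbb N}\to\mathbb N^{\mathbb N}$ such that $p\mapsto H\langle p,G(K(p))\rangle$ is a realizer of $\mathrm{eCFC}_{\mathbb N}$ for every realizer $G$ of $\mathrm{TT}^1_2$. This holds for both usual meanings of ``$S$ is a copy of $2^{<\omega}$'': that $S$ is isomorphic to $2^{<\omega}$ with respect to the partial order of initial segments, and that $S$ is isomorphic to $2^{<\omega}$ with respect to the two relations ``$\tau$ is in the left subtree below $\sigma$''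 ($\sigma0\preceq\tau$) and ``$\tau$ is in the right subtree below $\sigma$'' ($\sigma1\preceq\tau$). -/

import Mathlib

namespace Weihrauch

/-! ### Computable partial functions on Baire space -/

/-- The initial segment `(p 0, …, p (n - 1))` of a point of Baire space. -/
def initSeg (p : ℕ → ℕ) (n : ℕ) : List ℕ := (List.range n).map p

/-- `F : ⊆ ℕ^ℕ → ℕ^ℕ` is computable (in the sense of type-two computability): there is a computable
function `φ` on finite words, monotone for the order of initial segments, such that, for every `p`
in the domain of `F`, the words `φ (p 0, …, p (n - 1))` are initial segments of `F p` of unbounded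
length. -/
def ComputableBaire (F : (ℕ → ℕ) →. (ℕ → ℕ)) : Prop :=
  ∃ φ : List ℕ → List ℕ, Computable φ ∧
    (∀ u v : List ℕ, u <+: v → φ u <+: φ v) ∧
    ∀ p q : ℕ → ℕ, q ∈ F p →
      (∀ n, ∃ m, φ (initSeg p n) = initSeg q m) ∧
      (∀ m, ∃ n, m ≤ (φ (initSeg p n)).length)

/-- The pairing `⟨p, q⟩` of two points of Baire space, by interleaving. -/
def pairing (p q : ℕ → ℕ) : ℕ → ℕ :=
  fun n => if n % 2 = 0 then p (n / 2) else q (n / 2)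

/-! ### Represented spaces, problems, Weihrauch reducibility -/

/-- A representation of `X`: a partial surjection from Baire space onto `X`, given by its graph;
`names p x` says that `p` is a name of `x`. -/
structure Representation (X : Type) where
  names : (ℕ → ℕ) → X → Prop
  unique : ∀ p x y, names p x → names p y → x = y
  surj : ∀ x, ∃ p, names p x

/-- A problem: a partial multivalued function `In ⇉ Out` between represented spaces. Its domain is
the set of those `x` for which `sol x` is nonempty. -/
structure Problem where
  In : Type
  Out : Type
  inRep : Representation In
  outRep : Representation Out
  sol : In → Set Out

/-- `F` is a realizer of `f`: it maps every name of every `x` in the domain of `f` to a name of some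
element of `f x`. -/
def Realizes (F : (ℕ → ℕ) →. (ℕ → ℕ)) (f : Problem) : Prop :=
  ∀ (p : ℕ → ℕ) (x : f.In), f.inRep.names p x → (f.sol x).Nonempty →
    ∃ q ∈ F p, ∃ y ∈ f.sol x, f.outRep.names q y

/-- Weihrauch reducibility `f ≤_W g`: there are computable `H, K : ⊆ ℕ^ℕ → ℕ^ℕ` such that
`p ↦ H ⟨p, G (K p)⟩` is a realizer of `f` for every realizer `G` of `g`. -/
def WeihrauchReducible (f g : Problem) : Prop :=
  ∃ H K : (ℕ → ℕ) →. (ℕ → ℕ), ComputableBaire H ∧ ComputableBaire K ∧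
    ∀ G : (ℕ → ℕ) →. (ℕ → ℕ), Realizes G g →
      Realizes (fun p => (K p).bind fun r => (G r).bind fun s => H (pairing p s)) f

/-! ### The represented spaces that occur -/

/-- The natural numbers: `p` is a name of `p 0`. -/
def natRep : Representation ℕ where
  names p n := p 0 = n
  unique _ _ _ hx hy := hx.symm.trans hy
  surj n := ⟨fun _ => n, rfl⟩

/-- The space `𝒜(ℕ)` of closed subsets of `ℕ` (all subsets, with negative information):
a name of `A` enumerates the complement of `A`, where `n + 1` stands for `n` and `0` for
"no information". -/
def closedNatRep : Representation (Set ℕ) where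
  names p A := ∀ n, n ∉ A ↔ ∃ i, p i = n + 1
  unique p A B hA hB := by
    ext n
    exact not_iff_not.mp ((hA n).trans (hB n).symm)
  surj A := by
    classical
    refine ⟨fun i => if i ∈ A then 0 else i + 1, fun n => ⟨fun h => ⟨n, by simp [h]⟩, ?_⟩⟩
    rintro ⟨i, hi⟩
    by_cases h : i ∈ A
    · simp [h] at hi
    · simp only [h, if_false, Nat.add_right_cancel_iff] at hi
      exact hi ▸ h

/-- The product of two represented spaces: `⟨p, q⟩` is a name of `(x, y)` if `p` is a name of `x`
and `q` is a name of `y`. -/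
def prodRep {X Y : Type} (δ : Representation X) (ε : Representation Y) :
    Representation (X × Y) where
  names r z := ∃ p q, r = pairing p q ∧ δ.names p z.1 ∧ ε.names q z.2
  unique := by
    rintro r ⟨x, y⟩ ⟨x', y'⟩ ⟨p, q, rfl, hp, hq⟩ ⟨p', q', h, hp', hq'⟩
    have h1 : p = p' := by
      funext n
      have := congrFun h (2 * n)
      simpa [pairing] using this
    have h2 : q = q' := by
      funext n
      have := congrFun h (2 * n + 1)
      have e : (2 * n + 1) / 2 = n := by omega
      simpa [pairing, e, Nat.add_mod] using this
    subst h1 h2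
    exact Prod.ext (δ.unique _ _ _ hp hp') (ε.unique _ _ _ hq hq')
  surj := by
    rintro ⟨x, y⟩
    obtain ⟨p, hp⟩ := δ.surj x
    obtain ⟨q, hq⟩ := ε.surj y
    exact ⟨pairing p q, p, q, rfl, hp, hq⟩

/-- The space of colourings of the full binary tree `2^{<ω}` (finite binary words) with `k` colours:
a name of `c` lists the colours of all vertices, along the standard coding of finite binary words
by natural numbers. -/
def colouringRep (k : ℕ) : Representation (List Bool → Fin k) where
  names p c := ∀ σ, p (Encodable.encode σ) = (c σ : ℕ)
  unique p c d hc hd := by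
    funext σ
    exact Fin.ext ((hc σ).symm.trans (hd σ))
  surj c := by
    refine ⟨fun n => ((Encodable.decode (α := List Bool) n).map fun σ => (c σ : ℕ)).getD 0, ?_⟩
    intro σ
    simp

/-- The space of sets of vertices of the full binary tree: a name of `S` is its characteristic
function. -/
def vertexSetRep : Representation (Set (List Bool)) where
  names p S := ∀ σ, (σ ∈ S ∧ p (Encodable.encode σ) = 1) ∨ (σ ∉ S ∧ p (Encodable.encode σ) = 0)
  unique p S T hS hT := by
    ext σ
    rcases hS σ with ⟨h1, h2⟩ | ⟨h1, h2⟩ <;> rcases hT σ with ⟨h3, h4⟩ | ⟨h3, h4⟩ <;> simp_all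
  surj S := by
    classical
    refine ⟨fun n => ((Encodable.decode (α := List Bool) n).map
      fun σ => if σ ∈ S then 1 else 0).getD 0, ?_⟩
    intro σ
    by_cases h : σ ∈ S <;> simp [h]

/-! ### The problems -/

/-- `eCFC_ℕ`: given `k` and `A ∈ 𝒜(ℕ)` whose complement has at most `k` elements, find an element
of `A`. -/
def eCFC : Problem where
  In := ℕ × Set ℕ
  Out := ℕ
  inRep := prodRep natRep closedNatRep
  outRep := natRep
  sol x := {n | (x.2)ᶜ.encard ≤ (x.1 : ℕ∞) ∧ n ∈ x.2}

/-- `S` is a copy of `2^{<ω}` as a partially ordered set: `(S, ≼) ≅ (2^{<ω}, ≼)`, where `≼` is the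
order of initial segments. -/
def IsOrderCopy (S : Set (List Bool)) : Prop :=
  ∃ f : List Bool → List Bool, Set.BijOn f Set.univ S ∧
    ∀ σ τ, f σ <+: f τ ↔ σ <+: τ

/-- `S` is a copy of `2^{<ω}` as a structure with the two relations "`τ` is in the left subtree below
`σ`" and "`τ` is in the right subtree below `σ`", that is, `τ` extends `σ0` and `σ1`
respectively. -/
def IsLeftRightCopy (S : Set (List Bool)) : Prop :=
  ∃ f : List Bool → List Bool, Set.BijOn f Set.univ S ∧
    ∀ (b : Bool) (σ τ : List Bool), f σ ++ [b] <+: f τ ↔ σ ++ [b] <+: τ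

/-- The tree pigeonhole principle `TT^1_k`, for a notion of copy of `2^{<ω}`: given a colouring of
`2^{<ω}` with `k` colours, find a monochromatic copy of `2^{<ω}`. -/
def TT1 (IsCopy : Set (List Bool) → Prop) (k : ℕ) : Problem where
  In := List Bool → Fin k
  Out := Set (List Bool)
  inRep := colouringRep k
  outRep := vertexSetRep
  sol c := {S | IsCopy S ∧ ∃ i : Fin k, ∀ σ ∈ S, c σ = i}

end Weihrauch

namespace Weihrauch

/-! ### A colouring of the binary tree attached to an enumeration -/

/-! Each vertex of the tree inherits from its parent a colour and a base, a vertex on the path down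
to it. The code of the base is a guess at an element of `A`. As soon as this code is seen to be
enumerated, both children become their own bases and take the other colour.

Let `k + 1` pairwise incomparable vertices of a monochromatic copy share the base `ρ`. If the code
of `ρ` were enumerated, the colour would eventually flip below each of them. The copy has
arbitrarily long vertices there of the old colour, so the colour must flip back, which requires a
base extending the given vertex to be enumerated as well. Incomparability makes these `k + 1` bases
distinct, but at most `k` numbers are enumerated. Hence the code of `ρ` lies in `A`
(`not_enumerated_of_incomparable`).

Such vertices exist and can be found by search: only finitely many numbers are enumerated, so bases
and colours are constant on every cone from some level on (`exists_stable_level`), and a copy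
contains infinite antichains in such a cone. The same level shows that the colouring has a
monochromatic copy. -/

/-- `n` is listed, with the convention of `closedNatRep`, in an odd position below `t` of `p`. -/
def Enumerated (p : ℕ → ℕ) (t n : ℕ) : Prop := ∃ i < t, i % 2 = 1 ∧ p i = n + 1

instance (p : ℕ → ℕ) (t n : ℕ) : Decidable (Enumerated p t n) :=
  inferInstanceAs (Decidable (∃ i < t, _))

theorem Enumerated.mono {p : ℕ → ℕ} {s t n : ℕ} (h : Enumerated p s n) (hst : s ≤ t) :
    Enumerated p t n := by
  obtain ⟨i, hi, h⟩ := h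
  exact ⟨i, hi.trans_le hst, h⟩

theorem enumerated_congr {p q : ℕ → ℕ} {t : ℕ} (h : ∀ i < t, p i = q i) (n : ℕ) :
    Enumerated p t n ↔ Enumerated q t n := by
  unfold Enumerated
  refine exists_congr fun i => and_congr_right fun hi => ?_
  rw [h i hi]

/-- One step down the tree. A state consists of the current vertex, its base, and its colour; when
the code of the base is enumerated, the next vertex becomes a base and the colour flips. -/
def treeStep (p : ℕ → ℕ) (s : List Bool × List Bool × Bool) (b : Bool) :
    List Bool × List Bool × Bool :=
  if Enumerated p (s.1.length + 1) (Encodable.encode s.2.1) then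
    (s.1 ++ [b], s.1 ++ [b], !s.2.2)
  else (s.1 ++ [b], s.2.1, s.2.2)

def treeState (p : ℕ → ℕ) (σ : List Bool) : List Bool × List Bool × Bool :=
  σ.foldl (treeStep p) ([], [], false)

def base (p : ℕ → ℕ) (σ : List Bool) : List Bool := (treeState p σ).2.1

def colour (p : ℕ → ℕ) (σ : List Bool) : Bool := (treeState p σ).2.2

theorem treeState_append (p : ℕ → ℕ) (σ : List Bool) (b : Bool) :
    treeState p (σ ++ [b]) = treeStep p (treeState p σ) b := by
  simp [treeState]

theorem treeState_fst (p : ℕ → ℕ) (σ : List Bool) : (treeState p σ).1 = σ := by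
  induction σ using List.reverseRecOn with
  | nil => rfl
  | append_singleton σ b ih =>
    rw [treeState_append, treeStep]
    split_ifs <;> simp [ih]

theorem base_append (p : ℕ → ℕ) (σ : List Bool) (b : Bool) :
    base p (σ ++ [b]) =
      if Enumerated p (σ.length + 1) (Encodable.encode (base p σ)) then σ ++ [b]
      else base p σ := by
  rw [base, treeState_append, treeStep, treeState_fst, ← base]
  split_ifs <;> rfl

theorem colour_append (p : ℕ → ℕ) (σ : List Bool) (b : Bool) :
    colour p (σ ++ [b]) =
      if Enumerated p (σ.length + 1) (Encodable.encode (base p σ)) then !colour p σ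
      else colour p σ := by
  rw [colour, treeState_append, treeStep, treeState_fst, ← base]
  split_ifs <;> rfl

/-- The test made on passing to a child looks only at positions below the length of that child. This
locality makes the colouring computable and lets bases be evaluated from an initial segment. -/
theorem treeState_congr {p q : ℕ → ℕ} (σ : List Bool) (h : ∀ i < σ.length, p i = q i) :
    treeState p σ = treeState q σ := by
  induction σ using List.reverseRecOn with
  | nil => rfl
  | append_singleton σ b ih =>
    rw [treeState_append, treeState_append, ih fun i hi => h i (by simp; omega), treeStep, treeStep,
      treeState_fst]
    have := enumerated_congr (t := σ.length + 1) (fun i hi => h i (by simpa using hi))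
      (Encodable.encode (treeState q σ).2.1)
    by_cases h' : Enumerated q (σ.length + 1) (Encodable.encode (treeState q σ).2.1)
    · rw [if_pos h', if_pos (this.2 h')]
    · rw [if_neg h', if_neg (mt this.1 h')]

/-- Below a vertex `σ`, either nothing has changed, or the colour has flipped once, or the code of
some base above `σ` is enumerated. -/
theorem base_append_trichotomy (p : ℕ → ℕ) (σ δ : List Bool) :
    (base p (σ ++ δ) = base p σ ∧ colour p (σ ++ δ) = colour p σ ∧
      (δ ≠ [] → ¬ Enumerated p (σ ++ δ).length (Encodable.encode (base p σ)))) ∨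
    (σ <+: base p (σ ++ δ) ∧ colour p (σ ++ δ) = !colour p σ) ∨
    ∃ ν, σ <+: ν ∧ ∃ t, Enumerated p t (Encodable.encode ν) := by
  induction δ using List.reverseRecOn with
  | nil => simp
  | append_singleton δ b ih =>
    rw [← List.append_assoc, base_append, colour_append]
    rcases ih with ⟨h1, h2, h3⟩ | ⟨h1, h2⟩ | h
    · rw [h1, h2]
      split_ifs with h
      · exact Or.inr (Or.inl ⟨by simp, rfl⟩)
      · exact Or.inl ⟨rfl, rfl, fun _ => by simpa [add_assoc] using h⟩
    -- The current base already extends `σ`; a second flip happens only if its code is enumerated.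
    · split_ifs with h
      · exact Or.inr (Or.inr ⟨_, h1, _, h⟩)
      · exact Or.inr (Or.inl ⟨h1, h2⟩)
    · exact Or.inr (Or.inr h)

/-- In `base_append_trichotomy`, absence of change is excluded because the enumeration is visible at
the level of `τ`, and a single flip is excluded by the equality of colours. -/
theorem exists_enumerated_extension {p : ℕ → ℕ} {σ τ : List Bool} {t : ℕ}
    (ht : Enumerated p t (Encodable.encode (base p σ))) (hστ : σ <+: τ)
    (hlt : σ.length < τ.length) (htτ : t ≤ τ.length) (hc : colour p τ = colour p σ) :
    ∃ ν, σ <+: ν ∧ ∃ t, Enumerated p t (Encodable.encode ν) := by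
  obtain ⟨δ, rfl⟩ := hστ
  rcases base_append_trichotomy p σ δ with ⟨-, -, h⟩ | ⟨-, h⟩ | h
  · refine absurd (ht.mono htτ) (h ?_)
    rintro rfl
    simp at hlt
  · simp [h] at hc
  · exact h

/-- If at most `k` numbers are enumerated, then the common base of `k + 1` pairwise incomparable
vertices, each of which has arbitrarily long extensions of its own colour, has a code that is never
enumerated. -/
theorem not_enumerated_of_incomparable {p : ℕ → ℕ} {k : ℕ}
    (hk : {n | ∃ t, Enumerated p t n}.encard ≤ k) {ρ : List Bool} (σ : Fin (k + 1) → List Bool)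
    (hbase : ∀ i, base p (σ i) = ρ) (hinc : ∀ i j, i ≠ j → ¬ σ i <+: σ j)
    (hext : ∀ i n, ∃ τ, σ i <+: τ ∧ n ≤ τ.length ∧ colour p τ = colour p (σ i)) (t : ℕ) :
    ¬ Enumerated p t (Encodable.encode ρ) := by
  intro ht
  have key : ∀ i, ∃ ν, σ i <+: ν ∧ ∃ t, Enumerated p t (Encodable.encode ν) := by
    intro i
    obtain ⟨τ, h1, h2, h3⟩ := hext i (t + ((σ i).length + 1))
    exact exists_enumerated_extension (t := t) (by rwa [hbase]) h1 (by omega) (by omega) h3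
  choose ν hν hνt using key
  have hinj : Function.Injective ν := by
    intro i j hij
    by_contra hne
    rcases List.prefix_or_prefix_of_prefix (hν i) (hij ▸ hν j) with h | h
    · exact hinc i j hne h
    · exact hinc j i (Ne.symm hne) h
  have hsub : Set.range (fun i => Encodable.encode (ν i)) ⊆ {n | ∃ t, Enumerated p t n} := by
    rintro _ ⟨i, rfl⟩
    exact hνt i
  have hcard := (Set.encard_le_encard hsub).trans hk
  rw [← Set.image_univ, Function.Injective.encard_image
    (f := fun i => Encodable.encode (ν i)) (Encodable.encode_injective.comp hinj)] at hcard
  simp only [Set.encard_univ, ENat.card_eq_coe_fintype_card, Fintype.card_fin] at hcard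
  have := ENat.natCast_le_natCast.1 hcard
  omega

theorem exists_stage_of_finite {p : ℕ → ℕ} (hfin : {n | ∃ t, Enumerated p t n}.Finite) :
    ∃ s, ∀ n, (∃ t, Enumerated p t n) → n < s ∧ Enumerated p s n := by
  have h : ∀ n, ∃ t, (∃ t, Enumerated p t n) → Enumerated p t n := fun n => by
    by_cases h : ∃ t, Enumerated p t n
    · exact ⟨h.choose, fun _ => h.choose_spec⟩
    · exact ⟨0, fun h' => absurd h' h⟩
  choose f hf using h
  obtain ⟨M, hM⟩ := (hfin.image fun n => n + 1 + f n).bddAbove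
  refine ⟨M, fun n hn => ?_⟩
  have := hM ⟨n, hn, rfl⟩
  simp only at this
  exact ⟨by omega, (hf n hn).mono (by omega)⟩

/-- If only finitely many numbers are enumerated, then from some level on neither the base nor the
colour changes. -/
theorem exists_stable_level {p : ℕ → ℕ} (hfin : {n | ∃ t, Enumerated p t n}.Finite) :
    ∃ L, ∀ σ : List Bool, L ≤ σ.length → ∀ δ,
      base p (σ ++ δ) = base p σ ∧ colour p (σ ++ δ) = colour p σ := by
  obtain ⟨s, hs⟩ := exists_stage_of_finite hfin
  have key : ∀ σ : List Bool, s + 1 ≤ σ.length →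
      ∀ t, ¬ Enumerated p t (Encodable.encode (base p σ)) := by
    intro σ hσ t ht
    obtain ⟨h1, h2⟩ := hs _ ⟨t, ht⟩
    induction σ using List.reverseRecOn with
    | nil => simp at hσ
    | append_singleton σ b =>
      simp only [List.length_append, List.length_singleton] at hσ
      rw [base_append] at h1 h2
      -- A new base is too long to have a code below `s`; an inherited base was tested at the parent
      -- at stage at least `s`, when everything ever enumerated had appeared.
      split_ifs at h1 h2 with h
      · have := Encodable.length_le_encode (σ ++ [b])
        simp only [List.length_append, List.length_singleton] at this
        omega
      · exact h (h2.mono (by omega))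
  refine ⟨s + 1, fun σ hσ δ => ?_⟩
  induction δ using List.reverseRecOn with
  | nil => simp
  | append_singleton δ b ih =>
    rw [← List.append_assoc, base_append, colour_append, ih.1, ih.2,
      if_neg (key σ hσ _), if_neg (key σ hσ _)]
    exact ⟨rfl, rfl⟩

/-! ### Copies of the binary tree -/

theorem prefix_iff_eq_or_append_prefix (σ τ : List Bool) :
    σ <+: τ ↔ σ = τ ∨ ∃ b, σ ++ [b] <+: τ := by
  constructor
  · rintro ⟨δ, rfl⟩
    cases δ with
    | nil => simp
    | cons b δ => exact Or.inr ⟨b, δ, by simp⟩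
  · rintro (rfl | ⟨b, h⟩)
    · exact List.prefix_rfl
    · exact (List.prefix_append _ _).trans h

/-- The prefix order is definable from equality and the two subtree relations. -/
theorem IsLeftRightCopy.isOrderCopy {S : Set (List Bool)} (h : IsLeftRightCopy S) :
    IsOrderCopy S := by
  obtain ⟨f, hf, h⟩ := h
  refine ⟨f, hf, fun σ τ => ?_⟩
  rw [prefix_iff_eq_or_append_prefix, prefix_iff_eq_or_append_prefix,
    (Set.injOn_univ.1 hf.injOn).eq_iff]
  simp only [h]

theorem isOrderCopy_cone (σ : List Bool) : IsOrderCopy (Set.range (σ ++ ·)) :=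
  ⟨(σ ++ ·), ⟨fun x _ => ⟨x, rfl⟩, (List.append_right_injective σ).injOn,
    by rintro _ ⟨x, rfl⟩; exact ⟨x, trivial, rfl⟩⟩, fun _ _ => List.prefix_append_right_inj σ⟩

theorem isLeftRightCopy_cone (σ : List Bool) : IsLeftRightCopy (Set.range (σ ++ ·)) :=
  ⟨(σ ++ ·), ⟨fun x _ => ⟨x, rfl⟩, (List.append_right_injective σ).injOn,
    by rintro _ ⟨x, rfl⟩; exact ⟨x, trivial, rfl⟩⟩,
    fun b x y => by
      simp only [List.append_assoc]
      exact List.prefix_append_right_inj σ⟩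

theorem IsOrderCopy.exists_long_extension {S : Set (List Bool)} (h : IsOrderCopy S)
    {σ : List Bool} (hσ : σ ∈ S) (n : ℕ) : ∃ τ ∈ S, σ <+: τ ∧ n ≤ τ.length := by
  obtain ⟨f, hf, h⟩ := h
  induction n with
  | zero => exact ⟨σ, hσ, List.prefix_rfl, Nat.zero_le _⟩
  | succ n ih =>
    obtain ⟨τ, hτ, h1, h2⟩ := ih
    obtain ⟨α, -, rfl⟩ := hf.surjOn hτ
    have h3 : f α <+: f (α ++ [true]) := (h _ _).2 (List.prefix_append _ _)
    refine ⟨f (α ++ [true]), hf.mapsTo trivial, h1.trans h3, ?_⟩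
    by_contra hlt
    have h4 : f α = f (α ++ [true]) := h3.eq_of_length_le (by omega)
    have := Set.injOn_univ.1 hf.injOn h4
    simp at this

theorem IsOrderCopy.exists_incomparable {S : Set (List Bool)} (h : IsOrderCopy S)
    {σ : List Bool} (hσ : σ ∈ S) :
    ∃ τ : ℕ → List Bool, (∀ i, τ i ∈ S ∧ σ <+: τ i) ∧ ∀ i j, i ≠ j → ¬ τ i <+: τ j := by
  obtain ⟨f, hf, h⟩ := h
  obtain ⟨α, -, rfl⟩ := hf.surjOn hσ
  -- The words `1^i 0` form an infinite antichain: for `i < j` they differ at position `i`.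
  refine ⟨fun i => f (α ++ (List.replicate i true ++ [false])),
    fun i => ⟨hf.mapsTo trivial, (h _ _).2 (List.prefix_append _ _)⟩, fun i j hij hp => hij ?_⟩
  rw [h, List.prefix_append_right_inj] at hp
  have hlen := hp.length_le
  simp only [List.length_append, List.length_replicate, List.length_singleton] at hlen
  by_contra hne
  have hlt : i < j := by omega
  have := hp.getElem (i := i) (by simp)
  simp [hlt] at this

/-! ### Initial segments and computable functions on Baire space -/

@[simp] theorem length_initSeg (p : ℕ → ℕ) (n : ℕ) : (initSeg p n).length = n := by
  simp [initSeg]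

theorem initSeg_getD (p : ℕ → ℕ) {n i : ℕ} (h : i < n) : (initSeg p n).getD i 0 = p i := by
  simp [initSeg, h]

theorem initSeg_prefix (p : ℕ → ℕ) {m n : ℕ} (h : m ≤ n) : initSeg p m <+: initSeg p n := by
  obtain ⟨d, rfl⟩ := Nat.exists_eq_add_of_le h
  rw [initSeg, initSeg, List.range_add, List.map_append]
  exact List.prefix_append _ _

theorem take_initSeg (p : ℕ → ℕ) {m n : ℕ} (h : m ≤ n) : (initSeg p n).take m = initSeg p m := by
  have := List.prefix_iff_eq_take.1 (initSeg_prefix p h)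
  rwa [length_initSeg, eq_comm] at this

theorem getD_eq_of_prefix {u v : List ℕ} (h : u <+: v) {i : ℕ} (hi : i < u.length) :
    v.getD i 0 = u.getD i 0 := by
  obtain ⟨w, rfl⟩ := h
  exact List.getD_append _ _ _ _ hi

/-- A function whose `m`-th output entry depends only on the input entries below `m` is computable
as soon as its entries are. -/
theorem computableBaire_of_local (f : (ℕ → ℕ) → ℕ → ℕ)
    (hloc : ∀ p q m, (∀ i < m, p i = q i) → f p m = f q m)
    (hf : Primrec₂ fun (u : List ℕ) m => f (fun i => u.getD i 0) m) :
    ComputableBaire fun p => Part.some (f p) := by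
  refine ⟨fun u => (List.range u.length).map (f fun i => u.getD i 0),
    (Primrec.list_map (Primrec.list_range.comp Primrec.list_length) hf).to_comp, ?_, ?_⟩
  · intro u v huv
    obtain ⟨d, hd⟩ := Nat.exists_eq_add_of_le huv.length_le
    simp only [hd, List.range_add, List.map_append]
    rw [List.map_congr_left (g := f fun i => v.getD i 0) fun m hm => hloc _ _ _ fun i hi =>
      (getD_eq_of_prefix huv (hi.trans (List.mem_range.1 hm))).symm]
    exact List.prefix_append _ _
  · rintro p q hq
    obtain rfl := Part.mem_some_iff.1 hq
    refine ⟨fun n => ⟨n, ?_⟩, fun m => ⟨m, by simp⟩⟩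
    simp only [length_initSeg]
    refine List.map_congr_left fun m hm => hloc _ _ _ fun i hi => ?_
    exact initSeg_getD p (hi.trans (List.mem_range.1 hm))

/-- The value of `g` at the shortest prefix of `w` on which it is defined. -/
def firstHit (g : List ℕ → Option ℕ) (w : List ℕ) : Option ℕ :=
  ((List.range (w.length + 1)).filterMap fun n => g (w.take n)).head?

/-- Shorter prefixes are tried first, so further input cannot change an answer. `g` itself need not
be monotone. -/
theorem firstHit_mono {g : List ℕ → Option ℕ} {u v : List ℕ} (huv : u <+: v) {x : ℕ}
    (h : firstHit g u = some x) : firstHit g v = some x := by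
  obtain ⟨d, hd⟩ := Nat.exists_eq_add_of_le huv.length_le
  have e : ∀ n ∈ List.range (u.length + 1), g (v.take n) = g (u.take n) := by
    intro n hn
    obtain ⟨w, rfl⟩ := huv
    rw [List.take_append_of_le_length (Nat.lt_succ_iff.1 (List.mem_range.1 hn))]
  rw [firstHit, hd, add_right_comm, List.range_add, List.filterMap_append,
    List.filterMap_congr e, List.head?_append]
  rw [firstHit] at h
  simp [h]

theorem exists_of_firstHit {g : List ℕ → Option ℕ} {w : List ℕ} {x : ℕ}
    (h : firstHit g w = some x) : ∃ n ≤ w.length, g (w.take n) = some x := by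
  have := List.mem_of_head? h
  simp only [List.mem_filterMap, List.mem_range] at this
  obtain ⟨n, hn, h⟩ := this
  exact ⟨n, by omega, h⟩

theorem exists_firstHit {g : List ℕ → Option ℕ} {w : List ℕ} {x : ℕ} (h : g w = some x) :
    ∃ y, firstHit g w = some y := by
  rw [← Option.isSome_iff_exists, firstHit, List.isSome_head?]
  refine List.ne_nil_of_mem (a := x) (List.mem_filterMap.2 ⟨w.length, by simp, by simpa using h⟩)

/-- The partial function on Baire space that searches for an initial segment of its argument on
which `g` is defined, and returns the constant sequence with that value. -/
noncomputable def searchFun (g : List ℕ → Option ℕ) : (ℕ → ℕ) →. (ℕ → ℕ) := fun p =>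
  ⟨∃ x n, firstHit g (initSeg p n) = some x, fun h _ => h.choose⟩

theorem exists_mem_searchFun {g : List ℕ → Option ℕ} {p : ℕ → ℕ} {n x : ℕ}
    (h : g (initSeg p n) = some x) :
    ∃ q ∈ searchFun g p, ∃ m, g (initSeg p m) = some (q 0) := by
  obtain ⟨y, hy⟩ := exists_firstHit h
  have hd : ∃ x n, firstHit g (initSeg p n) = some x := ⟨y, n, hy⟩
  refine ⟨fun _ => hd.choose, ⟨hd, rfl⟩, ?_⟩
  obtain ⟨n, hn⟩ := hd.choose_spec
  obtain ⟨m, hm, h⟩ := exists_of_firstHit hn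
  rw [length_initSeg] at hm
  rw [take_initSeg p hm] at h
  exact ⟨m, h⟩

theorem computableBaire_searchFun {g : List ℕ → Option ℕ} (hg : Primrec g) :
    ComputableBaire (searchFun g) := by
  have hfirst : Primrec (firstHit g) :=
    Primrec.list_head?.comp (Primrec.listFilterMap
      (Primrec.list_range.comp (Primrec.succ.comp Primrec.list_length))
      (hg.comp (Primrec.list_take.comp Primrec.snd Primrec.fst)).to₂)
  have hrep : Primrec₂ fun (w : List ℕ) (x : ℕ) => (List.range w.length).map fun _ => x :=
    Primrec.list_map (Primrec.list_range.comp (Primrec.list_length.comp Primrec.fst))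
      (Primrec.snd.comp Primrec.fst).to₂
  refine ⟨fun w => ((firstHit g w).map fun x => (List.range w.length).map fun _ => x).getD [],
    (Primrec.option_getD.comp (Primrec.option_map hfirst hrep) (Primrec.const [])).to_comp, ?_, ?_⟩
  · intro u v huv
    cases h : firstHit g u with
    | none => simp [h]
    | some x =>
      obtain ⟨d, hd⟩ := Nat.exists_eq_add_of_le huv.length_le
      simp only [h, firstHit_mono huv h, Option.map_some, Option.getD_some, hd, List.range_add,
        List.map_append]
      exact List.prefix_append _ _
  · rintro p _ ⟨hd, rfl⟩
    obtain ⟨N, hN⟩ := hd.choose_spec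
    -- By monotonicity every hit has the chosen value, so the choice in `searchFun` is harmless.
    have hval : ∀ n, N ≤ n → firstHit g (initSeg p n) = some hd.choose := fun n hn =>
      firstHit_mono (initSeg_prefix p hn) hN
    refine ⟨fun n => ?_, fun m => ⟨max m N, ?_⟩⟩
    · cases h : firstHit g (initSeg p n) with
      | none => exact ⟨0, by simp only [h]; rfl⟩
      | some x =>
        refine ⟨n, ?_⟩
        have h1 := firstHit_mono (initSeg_prefix p (le_max_left n N)) h
        rw [hval _ (le_max_right n N)] at h1
        obtain rfl := Option.some.inj h1
        simp only [h]
        simp [initSeg, searchFun]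
    · simp [hval _ (le_max_right m N)]

/-! ### Primitive recursiveness of the colouring -/

theorem primrecRel_exists_lt {β : Type*} [Primcodable β] {R : ℕ → β → Prop} (h : PrimrecRel R) :
    PrimrecRel fun n y => ∃ x < n, R x y :=
  (h.exists_mem_list.comp (Primrec.list_range.comp Primrec.fst) Primrec.snd).of_eq (by simp)

theorem primrecRel_forall_lt {β : Type*} [Primcodable β] {R : ℕ → β → Prop} (h : PrimrecRel R) :
    PrimrecRel fun n y => ∀ x < n, R x y :=
  (h.forall_mem_list.comp (Primrec.list_range.comp Primrec.fst) Primrec.snd).of_eq (by simp)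

/-- The factor `d` is 1 for reading `r` itself and 2 for reading `r` from the even entries of `⟨r,
s⟩`. -/
theorem primrec_enumerated (d : ℕ) : PrimrecPred fun a : List ℕ × ℕ × ℕ =>
    Enumerated (fun i => a.1.getD (d * i) 0) a.2.1 a.2.2 := by
  have h : PrimrecRel fun (i : ℕ) (y : List ℕ × ℕ) => i % 2 = 1 ∧ y.1.getD (d * i) 0 = y.2 + 1 := by
    refine PrimrecPred.and (Primrec.eq.comp (Primrec.nat_mod.comp Primrec.fst (Primrec.const 2))
      (Primrec.const 1)) (Primrec.eq.comp ((Primrec.list_getD 0).comp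
        (Primrec.fst.comp Primrec.snd) (Primrec.nat_mul.comp (Primrec.const d) Primrec.fst))
        (Primrec.succ.comp (Primrec.snd.comp Primrec.snd)))
  have h' := primrecRel_exists_lt h
  exact h'.comp (g := fun a : List ℕ × ℕ × ℕ => (a.1, a.2.2)) (Primrec.fst.comp Primrec.snd)
    (Primrec.fst.pair (Primrec.snd.comp Primrec.snd))

theorem primrec_treeState (d : ℕ) : Primrec₂ fun (u : List ℕ) (σ : List Bool) =>
    treeState (fun i => u.getD (d * i) 0) σ := by
  have hs : Primrec₂ fun (a : List ℕ × List Bool) (x : (List Bool × List Bool × Bool) × Bool) =>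
      treeStep (fun i => a.1.getD (d * i) 0) x.1 x.2 := by
    have hcur : Primrec fun y : (List ℕ × List Bool) × ((List Bool × List Bool × Bool) × Bool) =>
        y.2.1.1 := Primrec.fst.comp (Primrec.fst.comp Primrec.snd)
    have hbas : Primrec fun y : (List ℕ × List Bool) × ((List Bool × List Bool × Bool) × Bool) =>
        y.2.1.2.1 := Primrec.fst.comp (Primrec.snd.comp (Primrec.fst.comp Primrec.snd))
    have hcol : Primrec fun y : (List ℕ × List Bool) × ((List Bool × List Bool × Bool) × Bool) =>
        y.2.1.2.2 := Primrec.snd.comp (Primrec.snd.comp (Primrec.fst.comp Primrec.snd))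
    have hnew : Primrec fun y : (List ℕ × List Bool) × ((List Bool × List Bool × Bool) × Bool) =>
        y.2.1.1 ++ [y.2.2] := Primrec.list_concat.comp hcur (Primrec.snd.comp Primrec.snd)
    exact Primrec.ite ((primrec_enumerated d).comp
      ((Primrec.fst.comp Primrec.fst).pair ((Primrec.succ.comp (Primrec.list_length.comp hcur)).pair
        (Primrec.encode.comp hbas))))
      (hnew.pair (hnew.pair (Primrec.not.comp hcol))) (hnew.pair (hbas.pair hcol))
  exact Primrec.list_foldl Primrec.snd (Primrec.const ([], [], false)) hs

/-- The entries of the standard name of the colouring `colour p`. -/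
def colourName (p : ℕ → ℕ) (m : ℕ) : ℕ :=
  ((Encodable.decode (α := List Bool) m).map fun σ =>
    -- Always true, since a code is at least the length of its word; the explicit guard makes the
    -- locality in the first `m` entries immediate.
    if σ.length ≤ m then (colour p σ).toNat else 0).getD 0

theorem colourName_encode (p : ℕ → ℕ) (σ : List Bool) :
    colourName p (Encodable.encode σ) = (colour p σ).toNat := by
  simp [colourName, Encodable.length_le_encode]

theorem computableBaire_colourName : ComputableBaire fun p => Part.some (colourName p) := by
  refine computableBaire_of_local _ (fun p q m h => ?_) ?_
  · unfold colourName
    congr 2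
    funext σ
    split_ifs with hσ
    · rw [colour, treeState_congr σ fun i hi => h i (hi.trans_le hσ), ← colour]
    · rfl
  · have hc : Primrec₂ fun (a : List ℕ × ℕ) (σ : List Bool) =>
        if σ.length ≤ a.2 then (colour (fun i => a.1.getD i 0) σ).toNat else 0 := by
      refine Primrec.ite (Primrec.nat_le.comp (Primrec.list_length.comp Primrec.snd)
        (Primrec.snd.comp Primrec.fst)) ?_ (Primrec.const 0)
      refine (Primrec.dom_finite Bool.toNat).comp (Primrec.snd.comp (Primrec.snd.comp ?_))
      simpa using (primrec_treeState 1).comp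
        (Primrec.fst.comp (Primrec.fst (α := List ℕ × ℕ) (β := List Bool))) Primrec.snd
    exact Primrec.option_getD.comp
      (Primrec.option_map (Primrec.decode.comp Primrec.snd) hc) (Primrec.const 0)

/-! ### The search in a monochromatic copy -/

/-- The information of `w`, an initial segment of a point `⟨r, s⟩` with `r` a name of an instance
`(k, A)` and `s` the characteristic function of a set of vertices, suffices to see that `T` consists
of `k + 1` pairwise incomparable elements of that set with the same base. -/
def IsWitness (w : List ℕ) (T : List (List Bool)) : Prop :=
  T.length = w.getD 0 0 + 1 ∧
  (∀ σ ∈ T, w.getD (2 * Encodable.encode σ + 1) 0 = 1 ∧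
    base (fun i => w.getD (2 * i) 0) σ = base (fun i => w.getD (2 * i) 0) T.headI) ∧
  ∀ i < T.length, ∀ j < T.length, i ≠ j → ¬ T.getD i [] <+: T.getD j []

theorem primrec_base : Primrec₂ fun (w : List ℕ) (σ : List Bool) =>
    base (fun i => w.getD (2 * i) 0) σ :=
  Primrec.fst.comp (Primrec.snd.comp (primrec_treeState 2))

theorem primrec_isWitness : PrimrecRel IsWitness := by
  refine PrimrecPred.and ?_ (PrimrecPred.and ?_ ?_)
  · exact Primrec.eq.comp (Primrec.list_length.comp Primrec.snd)
      (Primrec.succ.comp ((Primrec.list_getD 0).comp Primrec.fst (Primrec.const 0)))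
  · have h : PrimrecRel fun (σ : List Bool) (a : List ℕ × List (List Bool)) =>
        a.1.getD (2 * Encodable.encode σ + 1) 0 = 1 ∧
          base (fun i => a.1.getD (2 * i) 0) σ = base (fun i => a.1.getD (2 * i) 0) a.2.headI := by
      have h1 : Primrec fun y : List Bool × (List ℕ × List (List Bool)) => y.2.1 :=
        Primrec.fst.comp Primrec.snd
      refine PrimrecPred.and (Primrec.eq.comp ((Primrec.list_getD 0).comp h1
        (Primrec.succ.comp (Primrec.nat_mul.comp (Primrec.const 2)
          (Primrec.encode.comp Primrec.fst)))) (Primrec.const 1)) ?_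
      exact Primrec.eq.comp (primrec_base.comp h1 Primrec.fst)
        (primrec_base.comp h1 (Primrec.list_headI.comp (Primrec.snd.comp Primrec.snd)))
    have h' := h.forall_mem_list
    exact h'.comp (g := fun a : List ℕ × List (List Bool) => a) Primrec.snd Primrec.id
  · have h : PrimrecRel fun (j : ℕ) (a : ℕ × List (List Bool)) =>
        a.1 ≠ j → ¬ a.2.getD a.1 [] <+: a.2.getD j [] := by
      have h1 : Primrec fun y : ℕ × (ℕ × List (List Bool)) => y.2.2.getD y.2.1 [] :=
        (Primrec.list_getD []).comp (Primrec.snd.comp Primrec.snd) (Primrec.fst.comp Primrec.snd)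
      have h2 : Primrec fun y : ℕ × (ℕ × List (List Bool)) => y.2.2.getD y.1 [] :=
        (Primrec.list_getD []).comp (Primrec.snd.comp Primrec.snd) Primrec.fst
      refine (PrimrecPred.or
        (Primrec.eq.comp (Primrec.fst.comp Primrec.snd) Primrec.fst)
        (Primrec.eq.comp h1
          (Primrec.list_take.comp (Primrec.list_length.comp h1) h2)).not).of_eq fun y => ?_
      simp only [List.prefix_iff_eq_take]
      tauto
    have h3 := primrecRel_forall_lt h
    have h4 : PrimrecRel fun (i : ℕ) (T : List (List Bool)) =>
        ∀ j < T.length, i ≠ j → ¬ T.getD i [] <+: T.getD j [] :=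
      h3.comp (Primrec.list_length.comp Primrec.snd) Primrec.id
    have h5 := primrecRel_forall_lt h4
    exact h5.comp (Primrec.list_length.comp Primrec.snd) Primrec.snd

open Classical in
/-- The code of the common base of the vertices in the list coded by the first component of the
length of `w`, if this list is a witness. -/
noncomputable def witnessSearch (w : List ℕ) : Option ℕ :=
  (Encodable.decode (α := List (List Bool)) w.length.unpair.1).bind fun T =>
    if IsWitness w T then some (Encodable.encode (base (fun i => w.getD (2 * i) 0) T.headI))
    else none

theorem primrec_witnessSearch : Primrec witnessSearch := by
  classical
  refine Primrec.option_bind (Primrec.decode.comp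
    (Primrec.fst.comp (Primrec.unpair.comp Primrec.list_length))) ?_
  exact Primrec.ite primrec_isWitness
    (Primrec.option_some.comp (Primrec.encode.comp
      (primrec_base.comp Primrec.fst (Primrec.list_headI.comp Primrec.snd)))) (Primrec.const none)

theorem pairing_even (r s : ℕ → ℕ) (i : ℕ) : pairing r s (2 * i) = r i := by
  simp [pairing]

theorem pairing_odd (r s : ℕ → ℕ) (i : ℕ) : pairing r s (2 * i + 1) = s i := by
  have e : (2 * i + 1) / 2 = i := by omega
  simp [pairing, e, Nat.add_mod]

theorem base_initSeg_pairing (r s : ℕ → ℕ) {n : ℕ} {σ : List Bool} (h : 2 * σ.length ≤ n) :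
    base (fun i => (initSeg (pairing r s) n).getD (2 * i) 0) σ = base r σ := by
  rw [base, treeState_congr (q := r), ← base]
  intro i hi
  rw [initSeg_getD _ (by omega), pairing_even]

theorem witnessSearch_sound {r s : ℕ → ℕ} {n x : ℕ}
    (h : witnessSearch (initSeg (pairing r s) n) = some x) :
    ∃ (ρ : List Bool) (τ : Fin (r 0 + 1) → List Bool), Encodable.encode ρ = x ∧
      (∀ i, base r (τ i) = ρ) ∧ (∀ i, s (Encodable.encode (τ i)) = 1) ∧
      ∀ i j, i ≠ j → ¬ τ i <+: τ j := by
  simp only [witnessSearch, Option.bind_eq_some_iff, Option.ite_none_right_eq_some] at h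
  obtain ⟨T, -, ⟨h1, h2, h3⟩, hx⟩ := h
  have hn : ∀ σ ∈ T, 2 * Encodable.encode σ + 1 < n := by
    intro σ hσ
    by_contra hlt
    have := (h2 σ hσ).1
    -- Beyond the initial segment the default value is 0, never 1, so the positions of a witness
    -- have really been read.
    rw [List.getD_eq_default _ _ (by rw [length_initSeg]; omega)] at this
    simp at this
  have hn0 : 0 < n := by
    have hT : T ≠ [] := by rintro rfl; simp at h1
    obtain ⟨σ, hσ⟩ := List.exists_mem_of_ne_nil T hT
    have := hn σ hσ
    omega
  rw [initSeg_getD _ hn0, show pairing r s 0 = r 0 from pairing_even r s 0] at h1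
  have hmem : ∀ i : Fin (r 0 + 1), T.getD i [] ∈ T := fun i => by
    rw [List.getD_eq_getElem _ _ (by omega)]
    exact List.getElem_mem _
  refine ⟨_, fun i => T.getD i [], Option.some.inj hx, fun i => ?_, fun i => ?_,
    fun i j hij => h3 i (by omega) j (by omega) (Fin.val_ne_of_ne hij)⟩
  · rw [← (h2 _ (hmem i)).2, base_initSeg_pairing]
    have := Encodable.length_le_encode (T.getD i [])
    have := hn _ (hmem i)
    omega
  · have := (h2 _ (hmem i)).1
    rwa [initSeg_getD _ (hn _ (hmem i)), pairing_odd] at this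

theorem exists_witnessSearch {r s : ℕ → ℕ} {ρ : List Bool} (τ : ℕ → List Bool)
    (hbase : ∀ i, base r (τ i) = ρ) (hs : ∀ i, s (Encodable.encode (τ i)) = 1)
    (hinc : ∀ i j, i ≠ j → ¬ τ i <+: τ j) :
    ∃ n x, witnessSearch (initSeg (pairing r s) n) = some x := by
  set T := (List.range (r 0 + 1)).map τ with hT
  obtain ⟨M, hM⟩ := (Set.finite_range fun i : Fin (r 0 + 1) => Encodable.encode (τ i)).bddAbove
  have hle : ∀ i < r 0 + 1, Encodable.encode (τ i) ≤ M := fun i hi => hM ⟨⟨i, hi⟩, rfl⟩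
  -- The first component makes the search try `T` at length `n`; the second makes `n` large enough
  -- for every entry that is consulted.
  set n := Nat.pair (Encodable.encode T) (2 * M + 2)
  have hn : 2 * M + 2 ≤ n := Nat.right_le_pair _ _
  have hb : ∀ i < r 0 + 1, base (fun i => (initSeg (pairing r s) n).getD (2 * i) 0) (τ i) = ρ := by
    intro i hi
    rw [base_initSeg_pairing, hbase]
    have := Encodable.length_le_encode (τ i)
    have := hle i hi
    omega
  have hw : IsWitness (initSeg (pairing r s) n) T := by
    refine ⟨?_, ?_, ?_⟩
    · rw [initSeg_getD _ (by omega), show pairing r s 0 = r 0 from pairing_even r s 0]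
      simp [hT]
    · intro σ hσ
      obtain ⟨i, hi, rfl⟩ := List.mem_map.1 hσ
      rw [List.mem_range] at hi
      have := hle i hi
      refine ⟨by rw [initSeg_getD _ (by omega), pairing_odd, hs], ?_⟩
      have hhead : T.headI = τ 0 := by simp [hT, List.range_succ_eq_map]
      rw [hb i hi, hhead, hb 0 (by omega)]
    · intro i hi j hj hij
      rw [List.getD_eq_getElem _ _ hi, List.getD_eq_getElem _ _ hj]
      simpa [hT] using hinc i j hij
  refine ⟨n, Encodable.encode
    (base (fun i => (initSeg (pairing r s) n).getD (2 * i) 0) T.headI), ?_⟩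
  rw [witnessSearch, length_initSeg, show n.unpair.1 = Encodable.encode T by simp [n],
    Encodable.encodek, Option.bind_some]
  exact if_pos hw

/-! ### The reduction -/

/-- Cones being copies puts the colouring in the domain of the problem; copies being order copies
provides the long extensions and the antichains. -/
theorem eCFC_reducible_of_isCopy {IsCopy : Set (List Bool) → Prop}
    (hcone : ∀ σ, IsCopy (Set.range (σ ++ ·))) (horder : ∀ S, IsCopy S → IsOrderCopy S) :
    WeihrauchReducible eCFC (TT1 IsCopy 2) := by
  refine ⟨searchFun witnessSearch, fun p => Part.some (colourName p),
    computableBaire_searchFun primrec_witnessSearch, computableBaire_colourName, ?_⟩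
  rintro G hG _ ⟨k, A⟩ ⟨p, q, rfl, hp, hq⟩ ⟨_, hcard, -⟩
  set r := pairing p q with hr
  have hr0 : r 0 = k := (pairing_even p q 0).trans hp
  have henum : ∀ n, n ∉ A ↔ ∃ t, Enumerated r t n := by
    intro n
    rw [hq n]
    constructor
    · rintro ⟨i, hi⟩
      -- Entry `i` of `q` sits at position `2 * i + 1` of the pairing.
      exact ⟨2 * i + 2, 2 * i + 1, by omega, by omega, (pairing_odd p q i).trans hi⟩
    · rintro ⟨t, i, -, hi, h⟩
      refine ⟨i / 2, ?_⟩
      rw [← h, ← pairing_odd p q, show 2 * (i / 2) + 1 = i by omega]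
  have hB : {n | ∃ t, Enumerated r t n} = Aᶜ := Set.ext fun n => (henum n).symm
  have hBk : {n | ∃ t, Enumerated r t n}.encard ≤ (r 0 : ℕ) := by
    rw [hB, hr0]
    exact hcard
  obtain ⟨L, hL⟩ := exists_stable_level (Set.finite_of_encard_le_coe hBk)
  let c : List Bool → Fin 2 := fun σ => if colour r σ then 1 else 0
  have hc : (TT1 IsCopy 2).inRep.names (colourName r) c := by
    intro σ
    rw [colourName_encode]
    simp only [c]
    cases colour r σ <;> rfl
  have hcol : ∀ σ τ, c σ = c τ → colour r σ = colour r τ := by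
    intro σ τ
    simp only [c]
    cases colour r σ <;> cases colour r τ <;> simp
  -- A realizer is constrained only on the domain, so a solution must be exhibited: any cone at the
  -- stable level.
  have hne : ((TT1 IsCopy 2).sol c).Nonempty := by
    refine ⟨_, hcone (List.replicate L true), c (List.replicate L true), ?_⟩
    rintro _ ⟨δ, rfl⟩
    simp only [c]
    rw [(hL _ (by simp) δ).2]
  obtain ⟨s, hs, S, ⟨hS, i, hmono⟩, hsS⟩ := hG _ c hc hne
  change Set (List Bool) at S
  have hO := horder S hS
  have hmem : ∀ σ, s (Encodable.encode σ) = 1 ↔ σ ∈ S := by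
    intro σ
    rcases hsS σ with ⟨h1, h2⟩ | ⟨h1, h2⟩ <;> simp [h1, h2]
  have hfound : ∃ n x, witnessSearch (initSeg (pairing r s) n) = some x := by
    obtain ⟨f, hf, -⟩ := id hO
    obtain ⟨σ, hσ, -, hlen⟩ := hO.exists_long_extension (hf.mapsTo (Set.mem_univ [])) L
    obtain ⟨τ, h1, h2⟩ := hO.exists_incomparable hσ
    refine exists_witnessSearch (ρ := base r σ) τ (fun i => ?_) (fun i => (hmem _).2 (h1 i).1) h2
    obtain ⟨δ, hδ⟩ := (h1 i).2
    rw [← hδ]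
    exact (hL σ hlen δ).1
  obtain ⟨n, x, hx⟩ := hfound
  obtain ⟨y, hy, m, hm⟩ := exists_mem_searchFun hx
  refine ⟨y, ?_, y 0, ⟨hcard, ?_⟩, rfl⟩
  · simp only [Part.bind_some, Part.mem_bind_iff]
    exact ⟨s, hs, hy⟩
  -- The witness found need not lie in the stable part of the tree; its correctness uses only the
  -- long extensions of the same colour inside `S`.
  · obtain ⟨ρ, τ, hρ, hbase, hτ, hinc⟩ := witnessSearch_sound hm
    by_contra hA
    obtain ⟨t, ht⟩ := (henum _).1 hA
    rw [← hρ] at ht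
    refine not_enumerated_of_incomparable hBk τ hbase hinc (fun j N => ?_) t ht
    have hj := (hmem _).1 (hτ j)
    obtain ⟨υ, hυ, h1, h2⟩ := hO.exists_long_extension hj N
    exact ⟨υ, h1, h2, hcol _ _ ((hmono _ hυ).trans (hmono _ hj).symm)⟩

end Weihrauch

theorem proposition17 :
    Weihrauch.WeihrauchReducible Weihrauch.eCFC (Weihrauch.TT1 Weihrauch.IsOrderCopy 2) ∧
    Weihrauch.WeihrauchReducible Weihrauch.eCFC
      (Weihrauch.TT1 Weihrauch.IsLeftRightCopy 2) := by
  exact ⟨Weihrauch.eCFC_reducible_of_isCopy Weihrauch.isOrderCopy_cone fun _ h => h,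
    Weihrauch.eCFC_reducible_of_isCopy Weihrauch.isLeftRightCopy_cone fun _ h => h.isOrderCopy⟩
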